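/- Let $d\ge 1$ and let $I_{2,d}$ be the graded $\mathbb{C}$-algebra of invariants of the binary form of degree $d$, i.e. the algebra of polynomials in the $d+1$ coefficients of the form $\sum_{i=0}^d a_i x^{d-i}y^i$ that are invariant under the action of $SL_2(\mathbb{C})$ by linear substitutions of $(x,y)$, graded by the degree in the coefficients. Let $P_{2,d}(T)=\sum_{n\ge 0}\dim_{\mathbb{C}}\bigl((I_{2,d})_n\bigr)\,T^n$ be its Poincaré series. For a positive integer $n$ and a formal power series $A=\sum_{m\ge 0}a_m z^m\in\mathbb{C}[[z]]$ put $\varphi_n(A)=\sum_{s\ge 0}a_{sn}T^s$, and let $(a,q)_n=(1-a)(1-aq)\cdots(1-aq^{n-1})$, with $(a,q)_0=1$. Then $$P_{2,d}(T)=\sum_{0\le k<d/2}\varphi_{d-2k}\left(\frac{(-1)^k z^{k(k+1)}(1-z^2)}{(z^2,z^2)_k\,(z^2,z^2)_{d-k}}\right)$$ in $\mathbb{C}[[T]]$, where the quotients are taken in $\mathbb{C}[[z]]$. -/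

import Mathlib

open MvPolynomial in
/-- The binary form `∑ aᵢ x^(d-i) y^i` of degree `d` with coefficient vector `a`
(the variables are `x = X 0` and `y = X 1`). -/
noncomputable def binaryForm (d : ℕ) (a : Fin (d + 1) → ℂ) : MvPolynomial (Fin 2) ℂ :=
  ∑ i : Fin (d + 1), C (a i) * X 0 ^ (d - (i : ℕ)) * X 1 ^ (i : ℕ)

open MvPolynomial in
/-- The linear substitution `x ↦ g₀₀ x + g₀₁ y`, `y ↦ g₁₀ x + g₁₁ y` applied to a polynomial
in `x, y`. -/
noncomputable def substForm (g : Matrix.SpecialLinearGroup (Fin 2) ℂ) :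
    MvPolynomial (Fin 2) ℂ →ₐ[ℂ] MvPolynomial (Fin 2) ℂ :=
  aeval fun i => ∑ j : Fin 2, C (g.1 i j) * X j

/-- The coefficients of `x^(d-i) y^i`, `0 ≤ i ≤ d`, of a polynomial in `x, y`. -/
noncomputable def formCoeffs (d : ℕ) (f : MvPolynomial (Fin 2) ℂ) : Fin (d + 1) → ℂ :=
  fun i => f.coeff (Finsupp.single 0 (d - (i : ℕ)) + Finsupp.single 1 (i : ℕ))

/-- The algebra of invariants of the binary form of degree `d`: the polynomials `F` in the
`d + 1` coefficients of the form whose value does not change when the form undergoes a linear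
substitution of determinant one. -/
noncomputable def binaryInvariants (d : ℕ) : Subalgebra ℂ (MvPolynomial (Fin (d + 1)) ℂ) where
  carrier := {F | ∀ (g : Matrix.SpecialLinearGroup (Fin 2) ℂ) (a : Fin (d + 1) → ℂ),
    MvPolynomial.eval (formCoeffs d (substForm g (binaryForm d a))) F = MvPolynomial.eval a F}
  mul_mem' := by
    intro F G hF hG g a
    rw [map_mul, map_mul, hF g a, hG g a]
  add_mem' := by
    intro F G hF hG g a
    rw [map_add, map_add, hF g a, hG g a]
  algebraMap_mem' := by
    intro c g a
    simp [MvPolynomial.algebraMap_eq]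

/-- The homogeneous component of degree `n` of the algebra of invariants. -/
noncomputable def binaryInvariantsOfDegree (d n : ℕ) :
    Submodule ℂ (MvPolynomial (Fin (d + 1)) ℂ) :=
  Subalgebra.toSubmodule (binaryInvariants d) ⊓ MvPolynomial.homogeneousSubmodule (Fin (d + 1)) ℂ n

/-- The Poincaré series of the algebra of invariants of the binary form of degree `d`. -/
noncomputable def binaryPoincareSeries (d : ℕ) : PowerSeries ℂ :=
  PowerSeries.mk fun n => (Module.finrank ℂ (binaryInvariantsOfDegree d n) : ℂ)

/-- The linear map `a₀ + a₁ z + a₂ z² + ⋯ ↦ a₀ + aₙ z + a₂ₙ z² + ⋯` on formal power series. -/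
noncomputable def phi (n : ℕ) : PowerSeries ℂ →ₗ[ℂ] PowerSeries ℂ where
  toFun A := PowerSeries.mk fun s => PowerSeries.coeff (n * s) A
  map_add' A B := by
    ext s
    simp
  map_smul' c A := by
    ext s
    simp

/-- The `q`-shifted factorial `(a, q)ₙ = (1 - a) (1 - a q) ⋯ (1 - a q^(n-1))`. -/
noncomputable def qShiftedFactorial (a q : PowerSeries ℂ) (n : ℕ) : PowerSeries ℂ :=
  ∏ i ∈ Finset.range n, (1 - a * q ^ i)

/-! Invariance under `SL₂` is infinitesimal: the group is generated by its two unipotent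
one-parameter subgroups, whose orbits are polynomial curves integrating the derivations `raiseDer`
and `lowerDer`. So the invariants are the common kernel of these derivations
(`mem_binaryInvariants_iff`), which together with `weightDer` satisfy the `sl₂` relations. On
polynomials of degree n the weights are bounded, so the lowering operator maps weight 0 onto weight
-2 and its kernel in weight 0 is exactly the space of invariants. The dimension is therefore a
difference of two weight multiplicities (`finrank_binaryInvariantsOfDegree`).

Weight spaces are spanned by monomials, so their multiplicities are coefficients of a Gaussian
polynomial in q = z². By `finrank_binaryInvariantsOfDegree_eq_coeff` the dimension is the
coefficient of z^(nd) in (1 - z²) times that polynomial. The product formula and the q-binomial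
theorem (`qShiftedFactorial_mul_tupleSeries`, `qShiftedFactorial_eq_sum`) write the Gaussian
polynomial as a sum over k in which n enters only through the factor z^(2nk). Removing this factor
turns the coefficient at nd into the coefficient at (d - 2k)n, which is what φ_(d-2k) extracts.
Terms with 2k ≥ d contribute nothing. -/

/-! ### Operators satisfying the `sl₂` relation on bounded weight spaces -/

section WeightSpaces

variable {V : Type*} [AddCommGroup V] [Module ℂ V]

/-- If `E`, `F` satisfy the `sl₂` relation on weight spaces that vanish in high weights, then
`E F` is injective on each weight space of positive weight. -/
theorem eq_zero_of_raise_lower_eq_zero (E F : V →ₗ[ℂ] V) (W : ℤ → Submodule ℂ V)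
    (hE : ∀ m, ∀ v ∈ W m, E v ∈ W (m + 2))
    (hEF : ∀ m, ∀ v ∈ W m, E (F v) - F (E v) = (m : ℂ) • v)
    (B : ℤ) (hB : ∀ m, B < m → W m = ⊥) {m : ℤ} (hm : 0 < m) {v : V} (hv : v ∈ W m)
    (h : E (F v) = 0) : v = 0 := by
  -- The statement is generalised to eigenvalues -c with c ≥ 0 so that it passes from v to E v: the
  -- relation gives F E v = -(c + m) v, so E v, of weight m + 2, has eigenvalue -(c + m) under E F.
  -- The induction climbs until the weight exceeds B. Once E v = 0, the same identity forces v = 0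
  -- because c + m > 0.
  suffices key : ∀ (k : ℕ) (m : ℤ), 0 < m → B < m + 2 * k → ∀ v ∈ W m, ∀ c : ℤ, 0 ≤ c →
      E (F v) = -(c : ℂ) • v → v = 0 by
    refine key (B.toNat) m hm ?_ v hv 0 le_rfl (by simp [h])
    have := Int.self_le_toNat B
    omega
  intro k
  induction k with
  | zero =>
    intro m hm hBm v hv c hc h
    rw [hB m (by simpa using hBm)] at hv
    simpa using hv
  | succ k ih =>
    intro m hm hBm v hv c hc h
    have hFE : F (E v) = -((c + m : ℤ) : ℂ) • v := by
      have := hEF m v hv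
      rw [h, sub_eq_iff_eq_add] at this
      have h2 : F (E v) = -(c : ℂ) • v - (m : ℂ) • v := by rw [this]; abel
      rw [h2]; push_cast; module
    have hEv : E v = 0 := by
      refine ih (m + 2) (by omega) (by push_cast at hBm; omega) (E v) (hE m v hv) (c + m)
        (by omega) ?_
      rw [hFE, map_smul]
    rw [hEv, map_zero] at hFE
    have := hFE.symm
    rw [smul_eq_zero] at this
    refine this.resolve_left ?_
    rw [neg_eq_zero]
    exact_mod_cast (by omega : c + m ≠ 0)

/-- The composite E F is an injective endomorphism of the finite-dimensional space `W 2`, hence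
surjective. So E maps `W 0` onto `W 2`, and rank-nullity gives the count. -/
theorem finrank_ker_raise (E F : V →ₗ[ℂ] V) (W : ℤ → Submodule ℂ V)
    [∀ m, FiniteDimensional ℂ (W m)]
    (hE : ∀ m, ∀ v ∈ W m, E v ∈ W (m + 2))
    (hF : ∀ m, ∀ v ∈ W m, F v ∈ W (m - 2))
    (hEF : ∀ m, ∀ v ∈ W m, E (F v) - F (E v) = (m : ℂ) • v)
    (B : ℤ) (hB : ∀ m, B < m → W m = ⊥) :
    Module.finrank ℂ (W 0 ⊓ LinearMap.ker E : Submodule ℂ V) + Module.finrank ℂ (W 2) =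
      Module.finrank ℂ (W 0) := by
  let e : W 0 →ₗ[ℂ] W 2 := E.restrict (fun v hv => by simpa using hE 0 v hv)
  let f : W 2 →ₗ[ℂ] W 0 := F.restrict (fun v hv => by simpa using hF 2 v hv)
  have hinj : Function.Injective (e ∘ₗ f) := by
    rw [← LinearMap.ker_eq_bot, LinearMap.ker_eq_bot']
    intro v hv
    have : E (F v) = 0 := congrArg Subtype.val hv
    exact Subtype.ext (eq_zero_of_raise_lower_eq_zero E F W hE hEF B hB two_pos v.2 this)
  have hsurj : Function.Surjective e := by
    have := LinearMap.injective_iff_surjective.1 hinj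
    rw [LinearMap.coe_comp] at this
    exact this.of_comp
  have h1 := LinearMap.finrank_range_add_finrank_ker e
  rw [LinearMap.range_eq_top.2 hsurj, finrank_top] at h1
  have h2 : LinearMap.ker e = (W 0 ⊓ LinearMap.ker E).comap (W 0).subtype := by
    ext v
    simp [e, LinearMap.mem_ker, Subtype.ext_iff]
  have h3 : Module.finrank ℂ (LinearMap.ker e) =
      Module.finrank ℂ (W 0 ⊓ LinearMap.ker E : Submodule ℂ V) := by
    rw [h2]
    exact (Submodule.comapSubtypeEquivOfLe inf_le_left).finrank_eq
  omega

end WeightSpaces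

/-! ### The derivations of `sl₂` on the coefficients of the form -/

section Derivations

open MvPolynomial

/-- The coordinate `aₖ` of a form of degree `d`, extended by zero to all integers `k`. -/
noncomputable def coord (d : ℕ) (k : ℤ) : MvPolynomial (Fin (d + 1)) ℂ :=
  if h : 0 ≤ k ∧ k ≤ d then X ⟨k.toNat, by omega⟩ else 0

theorem coord_coe (d : ℕ) (i : Fin (d + 1)) : coord d (i : ℕ) = X i := by
  have := i.2
  rw [coord, dif_pos ⟨by omega, by omega⟩]
  simp

theorem coord_eq_zero {d : ℕ} {k : ℤ} (h : ¬(0 ≤ k ∧ k ≤ d)) : coord d k = 0 := dif_neg h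

theorem coord_eq_X {d : ℕ} {k : ℤ} (h : 0 ≤ k ∧ k ≤ d) :
    ∃ i : Fin (d + 1), k = (i : ℕ) :=
  ⟨⟨k.toNat, by omega⟩, by simp [h.1]⟩

/-- The derivation `aₖ ↦ (k + 1) aₖ₊₁`, generating the substitutions `y ↦ y + s x`. -/
noncomputable def raiseDer (d : ℕ) :
    Derivation ℂ (MvPolynomial (Fin (d + 1)) ℂ) (MvPolynomial (Fin (d + 1)) ℂ) :=
  mkDerivation ℂ fun i => ((i : ℕ) + 1 : ℂ) • coord d ((i : ℕ) + 1)

/-- The derivation `aₖ ↦ (d - k + 1) aₖ₋₁`, generating the substitutions `x ↦ x + s y`. -/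
noncomputable def lowerDer (d : ℕ) :
    Derivation ℂ (MvPolynomial (Fin (d + 1)) ℂ) (MvPolynomial (Fin (d + 1)) ℂ) :=
  mkDerivation ℂ fun i => (d - (i : ℕ) + 1 : ℂ) • coord d ((i : ℕ) - 1)

/-- The diagonal derivation `Xᵢ ↦ cᵢ Xᵢ`. -/
noncomputable def diagDer {σ : Type*} (c : σ → ℂ) :
    Derivation ℂ (MvPolynomial σ ℂ) (MvPolynomial σ ℂ) :=
  mkDerivation ℂ fun i => c i • X i

theorem diagDer_X {σ : Type*} (c : σ → ℂ) (i : σ) : diagDer c (X i) = c i • X i :=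
  mkDerivation_X ..

/-- The extension by zero is compatible with the derivation because the factor k + 1 vanishes at k =
-1, the only place where a zero coordinate is followed by a nonzero one. Commutators can then be
computed without boundary cases. -/
theorem raiseDer_coord (d : ℕ) (k : ℤ) :
    raiseDer d (coord d k) = (k + 1 : ℂ) • coord d (k + 1) := by
  by_cases h : 0 ≤ k ∧ k ≤ d
  · obtain ⟨i, rfl⟩ := coord_eq_X h
    rw [coord_coe, raiseDer, mkDerivation_X]
    simp
  · rw [coord_eq_zero h, map_zero]
    by_cases h1 : k = -1
    · simp [h1]
    · rw [coord_eq_zero (by omega), smul_zero]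

/-- Here the critical index is k = d + 1, where the factor d - k + 1 vanishes. -/
theorem lowerDer_coord (d : ℕ) (k : ℤ) :
    lowerDer d (coord d k) = (d - k + 1 : ℂ) • coord d (k - 1) := by
  by_cases h : 0 ≤ k ∧ k ≤ d
  · obtain ⟨i, rfl⟩ := coord_eq_X h
    rw [coord_coe, lowerDer, mkDerivation_X]
    simp
  · rw [coord_eq_zero h, map_zero]
    by_cases h1 : k = d + 1
    · simp [h1]
    · rw [coord_eq_zero (by omega), smul_zero]

/-- The weight derivation `aₖ ↦ (2 k - d) aₖ`. -/
noncomputable def weightDer (d : ℕ) :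
    Derivation ℂ (MvPolynomial (Fin (d + 1)) ℂ) (MvPolynomial (Fin (d + 1)) ℂ) :=
  diagDer fun i => 2 * (i : ℕ) - d

/-- The Euler derivation `Xᵢ ↦ Xᵢ`. -/
noncomputable def eulerDer (σ : Type*) :
    Derivation ℂ (MvPolynomial σ ℂ) (MvPolynomial σ ℂ) :=
  diagDer fun _ => 1

theorem weightDer_coord (d : ℕ) (k : ℤ) :
    weightDer d (coord d k) = (2 * k - d : ℂ) • coord d k := by
  by_cases h : 0 ≤ k ∧ k ≤ d
  · obtain ⟨i, rfl⟩ := coord_eq_X h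
    rw [coord_coe, weightDer, diagDer_X]
    simp
  · rw [coord_eq_zero h, map_zero, smul_zero]

theorem eulerDer_coord (d : ℕ) (k : ℤ) :
    eulerDer (Fin (d + 1)) (coord d k) = coord d k := by
  by_cases h : 0 ≤ k ∧ k ≤ d
  · obtain ⟨i, rfl⟩ := coord_eq_X h
    rw [coord_coe, eulerDer, diagDer_X, one_smul]
  · rw [coord_eq_zero h, map_zero]

theorem derivation_ext_coord {d : ℕ}
    {D₁ D₂ : Derivation ℂ (MvPolynomial (Fin (d + 1)) ℂ) (MvPolynomial (Fin (d + 1)) ℂ)}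
    (h : ∀ k : ℤ, D₁ (coord d k) = D₂ (coord d k)) : D₁ = D₂ :=
  derivation_ext fun i => by simpa only [coord_coe] using h (i : ℕ)

theorem lie_raiseDer_lowerDer (d : ℕ) : ⁅raiseDer d, lowerDer d⁆ = weightDer d := by
  refine derivation_ext_coord fun k => ?_
  rw [Derivation.commutator_apply, lowerDer_coord, raiseDer_coord, Derivation.map_smul, Derivation.map_smul,
    lowerDer_coord, raiseDer_coord, weightDer_coord]
  simp only [add_sub_cancel_right, sub_add_cancel, smul_smul, ← sub_smul]
  congr 1
  push_cast
  ring

theorem lie_weightDer_raiseDer (d : ℕ) : ⁅weightDer d, raiseDer d⁆ = (2 : ℂ) • raiseDer d := by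
  refine derivation_ext_coord fun k => ?_
  rw [Derivation.commutator_apply, weightDer_coord, Derivation.smul_apply, raiseDer_coord,
    Derivation.map_smul, Derivation.map_smul, weightDer_coord, raiseDer_coord]
  simp only [smul_smul, ← sub_smul]
  congr 1
  push_cast
  ring

theorem lie_weightDer_lowerDer (d : ℕ) : ⁅weightDer d, lowerDer d⁆ = (-2 : ℂ) • lowerDer d := by
  refine derivation_ext_coord fun k => ?_
  rw [Derivation.commutator_apply, weightDer_coord, Derivation.smul_apply, lowerDer_coord,
    Derivation.map_smul, Derivation.map_smul, weightDer_coord, lowerDer_coord]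
  simp only [smul_smul, ← sub_smul]
  congr 1
  push_cast
  ring

theorem lie_eulerDer_raiseDer (d : ℕ) : ⁅eulerDer (Fin (d + 1)), raiseDer d⁆ = 0 := by
  refine derivation_ext_coord fun k => ?_
  rw [Derivation.commutator_apply, eulerDer_coord, Derivation.zero_apply, raiseDer_coord,
    Derivation.map_smul, eulerDer_coord, sub_self]

theorem lie_eulerDer_lowerDer (d : ℕ) : ⁅eulerDer (Fin (d + 1)), lowerDer d⁆ = 0 := by
  refine derivation_ext_coord fun k => ?_
  rw [Derivation.commutator_apply, eulerDer_coord, Derivation.zero_apply, lowerDer_coord,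
    Derivation.map_smul, eulerDer_coord, sub_self]

theorem diagDer_monomial {σ : Type*} (c : σ → ℂ) (α : σ →₀ ℕ) (r : ℂ) :
    diagDer c (monomial α r) = (α.sum fun i k => k * c i) • monomial α r := by
  classical
  rw [diagDer, mkDerivation_monomial, Finsupp.sum, Finsupp.sum, Finset.sum_smul, Finset.smul_sum]
  refine Finset.sum_congr rfl fun i hi => ?_
  have h : α - Finsupp.single i 1 + Finsupp.single i 1 = α :=
    tsub_add_cancel_of_le (by simpa [Nat.one_le_iff_ne_zero] using hi)
  rw [smul_eq_mul, mul_smul_comm, X, monomial_mul, h, smul_monomial, smul_monomial, smul_monomial]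
  congr 1
  simp only [smul_eq_mul]
  ring

theorem coeff_diagDer {σ : Type*} (c : σ → ℂ) (α : σ →₀ ℕ) (p : MvPolynomial σ ℂ) :
    coeff α (diagDer c p) = (α.sum fun i k => k * c i) * coeff α p := by
  classical
  induction p using MvPolynomial.induction_on' with
  | monomial β a =>
    rw [diagDer_monomial, coeff_smul, coeff_monomial]
    split_ifs with h
    · rw [h, smul_eq_mul]
    · simp
  | add p q hp hq => rw [map_add, coeff_add, coeff_add, hp, hq, mul_add]

/-- Monomials are eigenvectors of a diagonal derivation. This links eigenspaces, on which
commutators act, to spans of monomials, which can be counted. -/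
theorem diagDer_eq_smul_iff {σ : Type*} (c : σ → ℂ) (r : ℂ) (p : MvPolynomial σ ℂ) :
    diagDer c p = r • p ↔ ∀ α ∈ p.support, (α.sum fun i k => k * c i) = r := by
  rw [MvPolynomial.ext_iff]
  refine forall_congr' fun α => ?_
  rw [coeff_diagDer, coeff_smul, smul_eq_mul, mem_support_iff, mul_eq_mul_right_iff]
  tauto

end Derivations

/-! ### Constancy along polynomial integral curves -/

section OneParameter

open MvPolynomial

/-- The chain rule for a polynomial curve that is an integral curve of a derivation. -/
theorem derivative_aeval_eq {σ : Type*}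
    (D : Derivation ℂ (MvPolynomial σ ℂ) (MvPolynomial σ ℂ)) (A : σ → Polynomial ℂ)
    (hA : ∀ i, Polynomial.derivative (A i) = aeval A (D (X i))) (F : MvPolynomial σ ℂ) :
    Polynomial.derivative (aeval A F) = aeval A (D F) := by
  induction F using MvPolynomial.induction_on with
  | C a => simp
  | add p q hp hq => simp [hp, hq]
  | mul_X p i hp =>
    rw [map_mul, Polynomial.derivative_mul, hp, aeval_X, hA, Derivation.leibniz, map_add,
      smul_eq_mul, smul_eq_mul, map_mul, map_mul, aeval_X]
    ring

theorem eval_aeval_polynomial {σ : Type*} (A : σ → Polynomial ℂ) (F : MvPolynomial σ ℂ) (s : ℂ) :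
    (aeval A F).eval s = eval (fun i => (A i).eval s) F := by
  rw [← Polynomial.coe_evalRingHom, ← RingHom.coe_coe (aeval A), ← RingHom.comp_apply]
  congr 1
  ext i <;> simp

/-- A polynomial is constant along the integral curves of a derivation, one starting at each
point, if and only if the derivation kills it. -/
theorem eval_curve_eq_iff {σ : Type*}
    (D : Derivation ℂ (MvPolynomial σ ℂ) (MvPolynomial σ ℂ)) (A : (σ → ℂ) → σ → Polynomial ℂ)
    (hA : ∀ a i, Polynomial.derivative (A a i) = aeval (A a) (D (X i)))
    (h0 : ∀ a i, (A a i).eval 0 = a i) (F : MvPolynomial σ ℂ) :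
    (∀ (s : ℂ) (a : σ → ℂ), eval (fun i => (A a i).eval s) F = eval a F) ↔ D F = 0 := by
  constructor
  · intro h
    refine MvPolynomial.funext fun a => ?_
    have h1 : aeval (A a) F = Polynomial.C (eval a F) :=
      Polynomial.funext fun s => by rw [eval_aeval_polynomial, h, Polynomial.eval_C]
    have h2 := derivative_aeval_eq D (A a) (hA a) F
    rw [h1, Polynomial.derivative_C] at h2
    -- At parameter 0 the curve is at a, so the vanishing derivative says that D F vanishes at a.
    have h3 := congrArg (Polynomial.eval 0) h2
    rw [eval_aeval_polynomial] at h3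
    simp only [h0, Polynomial.eval_zero] at h3
    rw [← h3, map_zero]
  · intro h s a
    have h2 := derivative_aeval_eq D (A a) (hA a) F
    rw [h, map_zero] at h2
    have h3 := Polynomial.eq_C_of_derivative_eq_zero h2
    rw [← eval_aeval_polynomial, h3, Polynomial.eval_C, Polynomial.coeff_zero_eq_eval_zero,
      eval_aeval_polynomial]
    simp only [h0]

end OneParameter

/-! ### The action of `SL₂` and the infinitesimal criterion for invariance -/

section Substitutions

open MvPolynomial

theorem coeff_X_pow_mul_X_pow (p q r s : ℕ) :
    coeff (Finsupp.single 0 p + Finsupp.single 1 q)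
      ((X 0 ^ r * X 1 ^ s : MvPolynomial (Fin 2) ℂ)) = if r = p ∧ s = q then 1 else 0 := by
  classical
  rw [X_pow_eq_monomial, X_pow_eq_monomial, monomial_mul, coeff_monomial, one_mul]
  refine if_congr ?_ rfl rfl
  rw [Finsupp.ext_iff]
  simp [Fin.forall_fin_two]

theorem formCoeffs_binaryForm (d : ℕ) (a : Fin (d + 1) → ℂ) :
    formCoeffs d (binaryForm d a) = a := by
  funext j
  rw [formCoeffs, binaryForm, coeff_sum, Finset.sum_eq_single j]
  · rw [mul_assoc, coeff_C_mul, coeff_X_pow_mul_X_pow]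
    simp
  · intro i _ hij
    rw [mul_assoc, coeff_C_mul, coeff_X_pow_mul_X_pow, if_neg, mul_zero]
    exact fun h => hij (Fin.ext h.2)
  · simp

theorem isHomogeneous_binaryForm (d : ℕ) (a : Fin (d + 1) → ℂ) :
    (binaryForm d a).IsHomogeneous d := by
  refine IsHomogeneous.sum _ _ _ fun i _ => ?_
  have h : d = 0 + (d - (i : ℕ)) + (i : ℕ) := by have := i.2; omega
  conv_rhs => rw [h]
  exact ((isHomogeneous_C _ _).mul (isHomogeneous_X_pow _ _)).mul (isHomogeneous_X_pow _ _)

theorem binaryForm_formCoeffs {d : ℕ} {f : MvPolynomial (Fin 2) ℂ} (hf : f.IsHomogeneous d) :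
    binaryForm d (formCoeffs d f) = f := by
  ext m
  have hm : m = Finsupp.single 0 (m 0) + Finsupp.single 1 (m 1) := by
    ext i
    fin_cases i <;> simp
  have hdeg : m.degree = m 0 + m 1 := by
    rw [Finsupp.degree_eq_sum, Fin.sum_univ_two]
  by_cases h : m.degree = d
  · have h1 : m 1 < d + 1 := by omega
    have h2 := congrFun (formCoeffs_binaryForm d (formCoeffs d f)) ⟨m 1, h1⟩
    have h3 : m = Finsupp.single 0 (d - m 1) + Finsupp.single 1 (m 1) := by
      conv_lhs => rw [hm]
      congr 2
      omega
    simp only [formCoeffs] at h2 ⊢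
    rwa [← h3] at h2
  · rw [hf.coeff_eq_zero h, (isHomogeneous_binaryForm d _).coeff_eq_zero h]

theorem isHomogeneous_substForm {d : ℕ} {f : MvPolynomial (Fin 2) ℂ} (hf : f.IsHomogeneous d)
    (g : Matrix.SpecialLinearGroup (Fin 2) ℂ) : (substForm g f).IsHomogeneous d := by
  rw [← one_mul d]
  refine hf.aeval (fun i => ∑ j : Fin 2, C (g.1 i j) * X j) fun i =>
    IsHomogeneous.sum _ _ _ fun j _ => ?_
  exact (isHomogeneous_C_mul_X (g.1 i j) j)

/-- The order is reversed: substitution of variables is a right action on forms. -/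
theorem substForm_mul (g h : Matrix.SpecialLinearGroup (Fin 2) ℂ) :
    substForm (g * h) = (substForm h).comp (substForm g) := by
  refine MvPolynomial.algHom_ext fun i => ?_
  simp only [substForm, AlgHom.comp_apply, aeval_X, Matrix.SpecialLinearGroup.coe_mul,
    Matrix.mul_apply, Fin.sum_univ_two, map_add, map_mul, algHom_C, algebraMap_eq]
  ring

/-- The coefficients of the form with coefficients `a` after the substitution `g`. -/
noncomputable def substCoeffs (d : ℕ) (g : Matrix.SpecialLinearGroup (Fin 2) ℂ)
    (a : Fin (d + 1) → ℂ) : Fin (d + 1) → ℂ :=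
  formCoeffs d (substForm g (binaryForm d a))

theorem substCoeffs_mul (d : ℕ) (g h : Matrix.SpecialLinearGroup (Fin 2) ℂ)
    (a : Fin (d + 1) → ℂ) :
    substCoeffs d (g * h) a = substCoeffs d h (substCoeffs d g a) := by
  rw [substCoeffs, substCoeffs, substCoeffs, substForm_mul, AlgHom.comp_apply,
    binaryForm_formCoeffs (isHomogeneous_substForm (isHomogeneous_binaryForm d a) g)]

/-- The substitution `y ↦ s x + y`. -/
def lowerUnipotent (s : ℂ) : Matrix.SpecialLinearGroup (Fin 2) ℂ :=
  ⟨!![1, 0; s, 1], by simp [Matrix.det_fin_two]⟩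

/-- The substitution `x ↦ x + s y`. -/
def upperUnipotent (s : ℂ) : Matrix.SpecialLinearGroup (Fin 2) ℂ :=
  ⟨!![1, s; 0, 1], by simp [Matrix.det_fin_two]⟩

theorem val_mul_eq_fin_two (g h : Matrix.SpecialLinearGroup (Fin 2) ℂ) :
    (g * h).1 = !![g.1 0 0 * h.1 0 0 + g.1 0 1 * h.1 1 0, g.1 0 0 * h.1 0 1 + g.1 0 1 * h.1 1 1;
      g.1 1 0 * h.1 0 0 + g.1 1 1 * h.1 1 0, g.1 1 0 * h.1 0 1 + g.1 1 1 * h.1 1 1] := by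
  change g.1 * h.1 = _
  ext i j
  fin_cases i <;> fin_cases j <;> simp [Matrix.mul_apply, Fin.sum_univ_two]

/-- The two outer parameters are forced by the diagonal entries of the product; the upper right
entry then agrees because the determinant is 1. -/
theorem eq_mul_unipotent (g : Matrix.SpecialLinearGroup (Fin 2) ℂ) (h : g.1 1 0 ≠ 0) :
    g = upperUnipotent ((g.1 0 0 - 1) / g.1 1 0) * lowerUnipotent (g.1 1 0) *
      upperUnipotent ((g.1 1 1 - 1) / g.1 1 0) := by
  have hdet := g.2
  rw [Matrix.det_fin_two] at hdet
  ext i j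
  rw [val_mul_eq_fin_two, val_mul_eq_fin_two]
  fin_cases i <;> fin_cases j <;>
    simp [upperUnipotent, lowerUnipotent] <;> field_simp <;>
    first | ring1 | linear_combination (-1 : ℂ) * hdet

/-- `SL₂` is generated by the two unipotent one-parameter subgroups. -/
theorem specialLinearGroup_induction {P : Matrix.SpecialLinearGroup (Fin 2) ℂ → Prop}
    (hmul : ∀ g h, P g → P h → P (g * h)) (hU : ∀ s, P (upperUnipotent s))
    (hL : ∀ s, P (lowerUnipotent s)) (g : Matrix.SpecialLinearGroup (Fin 2) ℂ) : P g := by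
  have key : ∀ g : Matrix.SpecialLinearGroup (Fin 2) ℂ, g.1 1 0 ≠ 0 → P g := fun g h => by
    rw [eq_mul_unipotent g h]
    exact hmul _ _ (hmul _ _ (hU _) (hL _)) (hU _)
  by_cases h : g.1 1 0 = 0
  -- When the lower left entry is 0, multiplying by `lowerUnipotent 1` replaces it by the lower
  -- right entry, which is nonzero by the determinant condition.
  · have hg : g = g * lowerUnipotent 1 * lowerUnipotent (-1) := by
      ext i j
      rw [val_mul_eq_fin_two, val_mul_eq_fin_two]
      fin_cases i <;> fin_cases j <;> simp [lowerUnipotent]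
    rw [hg]
    refine hmul _ _ (key _ ?_) (hL _)
    have hdet := g.2
    rw [Matrix.det_fin_two, h, mul_zero, sub_zero] at hdet
    have h1 : g.1 1 1 ≠ 0 := right_ne_zero_of_mul (hdet ▸ one_ne_zero)
    rw [val_mul_eq_fin_two]
    simpa [lowerUnipotent, h] using h1
  · exact key g h

theorem substForm_lowerUnipotent_binaryForm (d : ℕ) (s : ℂ) (a : Fin (d + 1) → ℂ) :
    substForm (lowerUnipotent s) (binaryForm d a) =
      ∑ i : Fin (d + 1), C (a i) * (X 0 ^ (d - (i : ℕ)) * (C s * X 0 + X 1) ^ (i : ℕ)) := by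
  simp [substForm, binaryForm, lowerUnipotent, Fin.sum_univ_two, mul_assoc, algebraMap_eq]

theorem substForm_upperUnipotent_binaryForm (d : ℕ) (s : ℂ) (a : Fin (d + 1) → ℂ) :
    substForm (upperUnipotent s) (binaryForm d a) =
      ∑ i : Fin (d + 1), C (a i) * ((X 0 + C s * X 1) ^ (d - (i : ℕ)) * X 1 ^ (i : ℕ)) := by
  simp [substForm, binaryForm, upperUnipotent, Fin.sum_univ_two, mul_assoc, algebraMap_eq]

/-- For j > i the truncated exponent i - j is harmless, since the binomial coefficient is 0. -/
theorem coeff_lowerUnipotent {d i j : ℕ} (hi : i ≤ d) (s : ℂ) :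
    coeff (Finsupp.single 0 (d - j) + Finsupp.single 1 j)
      (X 0 ^ (d - i) * (C s * X 0 + X 1) ^ i : MvPolynomial (Fin 2) ℂ) =
      i.choose j * s ^ (i - j) := by
  have h : ∀ m ∈ Finset.range (i + 1), (X 0 ^ (d - i) *
      (X 1 ^ m * (C s * X 0) ^ (i - m) * (i.choose m : MvPolynomial (Fin 2) ℂ))) =
      C (i.choose m * s ^ (i - m) : ℂ) * (X 0 ^ (d - m) * X 1 ^ m) := fun m hm => by
    have h1 : d - m = (d - i) + (i - m) := by rw [Finset.mem_range] at hm; omega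
    rw [h1, pow_add, mul_pow, map_mul, map_pow, map_natCast]
    ring
  rw [add_comm (C s * X 0), add_pow, Finset.mul_sum, Finset.sum_congr rfl h, coeff_sum]
  simp only [coeff_C_mul, coeff_X_pow_mul_X_pow]
  by_cases hj : j ≤ i
  · rw [Finset.sum_eq_single j]
    · simp
    · intro m _ hm
      simp [hm]
    · intro hj'
      simp at hj'
      omega
  · rw [Nat.choose_eq_zero_of_lt (by omega), Finset.sum_eq_zero]
    · simp
    · intro m hm
      rw [Finset.mem_range] at hm
      rw [if_neg (by omega), mul_zero]

theorem coeff_upperUnipotent {d i j : ℕ} (hi : i ≤ d) (hjd : j ≤ d) (s : ℂ) :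
    coeff (Finsupp.single 0 (d - j) + Finsupp.single 1 j)
      ((X 0 + C s * X 1) ^ (d - i) * X 1 ^ i : MvPolynomial (Fin 2) ℂ) =
      (d - i).choose (d - j) * s ^ (j - i) := by
  have h : ∀ m ∈ Finset.range (d - i + 1),
      (X 0 ^ m * (C s * X 1) ^ (d - i - m) * ((d - i).choose m : MvPolynomial (Fin 2) ℂ)) * X 1 ^ i
      = C ((d - i).choose m * s ^ (d - i - m) : ℂ) * (X 0 ^ m * X 1 ^ (d - m)) := fun m hm => by
    have h1 : d - m = (d - i - m) + i := by rw [Finset.mem_range] at hm; omega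
    rw [h1, pow_add, mul_pow, map_mul, map_pow, map_natCast]
    ring
  rw [add_pow, Finset.sum_mul, Finset.sum_congr rfl h, coeff_sum]
  simp only [coeff_C_mul, coeff_X_pow_mul_X_pow]
  by_cases hj : i ≤ j
  · rw [Finset.sum_eq_single (d - j)]
    · have h1 : d - i - (d - j) = j - i := by omega
      rw [if_pos (by omega), h1, mul_one]
    · intro m _ hm
      simp [hm]
    · intro hj'
      simp at hj'
      omega
  · rw [Nat.choose_eq_zero_of_lt (by omega), Finset.sum_eq_zero]
    · simp
    · intro m hm
      rw [Finset.mem_range] at hm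
      rw [if_neg (by omega), mul_zero]

/-- The orbit of `a` under the lower unipotent group, as a polynomial curve. -/
noncomputable def lowerCurve (d : ℕ) (a : Fin (d + 1) → ℂ) (j : ℕ) : Polynomial ℂ :=
  ∑ i : Fin (d + 1), Polynomial.C (a i * (i : ℕ).choose j) * Polynomial.X ^ ((i : ℕ) - j)

/-- The orbit of `a` under the upper unipotent group, as a polynomial curve. -/
noncomputable def upperCurve (d : ℕ) (a : Fin (d + 1) → ℂ) (j : ℕ) : Polynomial ℂ :=
  ∑ i : Fin (d + 1),
    Polynomial.C (a i * (d - (i : ℕ)).choose (d - j)) * Polynomial.X ^ (j - (i : ℕ))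

theorem substCoeffs_lowerUnipotent (d : ℕ) (s : ℂ) (a : Fin (d + 1) → ℂ) :
    substCoeffs d (lowerUnipotent s) a = fun j : Fin (d + 1) => (lowerCurve d a j).eval s := by
  funext j
  rw [substCoeffs, formCoeffs, substForm_lowerUnipotent_binaryForm, coeff_sum, lowerCurve,
    Polynomial.eval_finsetSum]
  refine Finset.sum_congr rfl fun i _ => ?_
  rw [coeff_C_mul, coeff_lowerUnipotent (Nat.lt_succ_iff.1 i.2)]
  simp [mul_assoc]

theorem substCoeffs_upperUnipotent (d : ℕ) (s : ℂ) (a : Fin (d + 1) → ℂ) :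
    substCoeffs d (upperUnipotent s) a = fun j : Fin (d + 1) => (upperCurve d a j).eval s := by
  funext j
  rw [substCoeffs, formCoeffs, substForm_upperUnipotent_binaryForm, coeff_sum, upperCurve,
    Polynomial.eval_finsetSum]
  refine Finset.sum_congr rfl fun i _ => ?_
  rw [coeff_C_mul, coeff_upperUnipotent (Nat.lt_succ_iff.1 i.2) (Nat.lt_succ_iff.1 j.2)]
  simp [mul_assoc]

theorem lowerCurve_eval_zero (d : ℕ) (a : Fin (d + 1) → ℂ) (j : Fin (d + 1)) :
    (lowerCurve d a j).eval 0 = a j := by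
  rw [lowerCurve, Polynomial.eval_finsetSum, Finset.sum_eq_single j]
  · simp
  · intro i _ hij
    rcases lt_or_gt_of_ne (fun h => hij (Fin.ext h) : (i : ℕ) ≠ j) with h | h
    · simp [Nat.choose_eq_zero_of_lt h]
    · simp [Nat.sub_ne_zero_of_lt h]
  · simp

theorem upperCurve_eval_zero (d : ℕ) (a : Fin (d + 1) → ℂ) (j : Fin (d + 1)) :
    (upperCurve d a j).eval 0 = a j := by
  rw [upperCurve, Polynomial.eval_finsetSum, Finset.sum_eq_single j]
  · simp
  · intro i _ hij
    rcases lt_or_gt_of_ne (fun h => hij (Fin.ext h) : (i : ℕ) ≠ j) with h | h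
    · simp [Nat.sub_ne_zero_of_lt h]
    · have := i.2
      simp [Nat.choose_eq_zero_of_lt (by omega : d - (i : ℕ) < d - j)]
  · simp

/-- This is (i - j) C(i, j) = (j + 1) C(i, j + 1) termwise; the factor j + 1 matches that of
`raiseDer`. -/
theorem derivative_lowerCurve (d : ℕ) (a : Fin (d + 1) → ℂ) (j : ℕ) :
    Polynomial.derivative (lowerCurve d a j) = Polynomial.C (j + 1 : ℂ) * lowerCurve d a (j + 1) := by
  rw [lowerCurve, lowerCurve, Polynomial.derivative_sum, Finset.mul_sum]
  refine Finset.sum_congr rfl fun i _ => ?_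
  rw [Polynomial.derivative_C_mul_X_pow, ← mul_assoc, ← map_mul, Nat.sub_sub]
  congr 2
  have := congrArg (Nat.cast (R := ℂ)) (Nat.choose_succ_right_eq (i : ℕ) j)
  push_cast at this
  linear_combination -a i * this

theorem derivative_upperCurve_zero (d : ℕ) (a : Fin (d + 1) → ℂ) :
    Polynomial.derivative (upperCurve d a 0) = 0 := by
  rw [upperCurve, Polynomial.derivative_sum]
  exact Finset.sum_eq_zero fun i _ => by simp

theorem derivative_upperCurve_succ (d : ℕ) (a : Fin (d + 1) → ℂ) (j : ℕ) (hj : j < d) :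
    Polynomial.derivative (upperCurve d a (j + 1)) = Polynomial.C (d - j : ℂ) * upperCurve d a j := by
  rw [upperCurve, upperCurve, Polynomial.derivative_sum, Finset.mul_sum]
  refine Finset.sum_congr rfl fun i _ => ?_
  rw [Polynomial.derivative_C_mul_X_pow, ← mul_assoc, ← map_mul, Nat.sub_right_comm,
    Nat.add_sub_cancel]
  congr 2
  -- The same binomial identity read from the other end: (j + 1 - i) C(d - i, d - j - 1) = (d - j)
  -- C(d - i, d - j).
  have := congrArg (Nat.cast (R := ℂ)) (Nat.choose_succ_right_eq (d - (i : ℕ)) (d - (j + 1)))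
  have h1 : d - (j + 1) + 1 = d - j := by omega
  have h2 : d - (i : ℕ) - (d - (j + 1)) = j + 1 - (i : ℕ) := by have := i.2; omega
  rw [h1, h2] at this
  push_cast [Nat.cast_sub hj.le] at this
  linear_combination -a i * this

theorem forall_eval_lowerUnipotent_iff (d : ℕ) (F : MvPolynomial (Fin (d + 1)) ℂ) :
    (∀ (s : ℂ) (a : Fin (d + 1) → ℂ),
      eval (substCoeffs d (lowerUnipotent s) a) F = eval a F) ↔ raiseDer d F = 0 := by
  simp only [substCoeffs_lowerUnipotent]
  refine eval_curve_eq_iff (raiseDer d) (fun a j => lowerCurve d a j) (fun a j => ?_)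
    (lowerCurve_eval_zero d) F
  rw [derivative_lowerCurve, ← coord_coe, raiseDer_coord, map_smul, Polynomial.smul_eq_C_mul]
  by_cases h : (j : ℕ) + 1 ≤ d
  · rw [show ((j : ℕ) : ℤ) + 1 = ((⟨j + 1, by omega⟩ : Fin (d + 1)) : ℕ) by simp, coord_coe,
      aeval_X]
    simp
  -- At j = d both sides vanish: the curve of index d + 1 has only zero binomial coefficients.
  · rw [coord_eq_zero (by omega), map_zero, mul_zero, lowerCurve, Finset.sum_eq_zero, mul_zero]
    intro i _
    rw [Nat.choose_eq_zero_of_lt (by have := i.2; omega)]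
    simp

theorem forall_eval_upperUnipotent_iff (d : ℕ) (F : MvPolynomial (Fin (d + 1)) ℂ) :
    (∀ (s : ℂ) (a : Fin (d + 1) → ℂ),
      eval (substCoeffs d (upperUnipotent s) a) F = eval a F) ↔ lowerDer d F = 0 := by
  simp only [substCoeffs_upperUnipotent]
  refine eval_curve_eq_iff (lowerDer d) (fun a j => upperCurve d a j) (fun a j => ?_)
    (upperCurve_eval_zero d) F
  rw [← coord_coe, lowerDer_coord, map_smul, Polynomial.smul_eq_C_mul]
  obtain ⟨j, hj⟩ := j
  cases j with
  | zero =>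
    rw [coord_eq_zero (by simp), map_zero, mul_zero]
    exact derivative_upperCurve_zero d a
  | succ j =>
    rw [show (((⟨j + 1, hj⟩ : Fin (d + 1)) : ℕ) : ℤ) - 1 =
      ((⟨j, by omega⟩ : Fin (d + 1)) : ℕ) by simp, coord_coe, aeval_X]
    refine (derivative_upperCurve_succ d a j (by omega)).trans ?_
    congr 2
    push_cast
    ring

/-- Invariance need only be tested on the generating unipotent subgroups, and on each of them it
means being killed by the corresponding derivation. -/
theorem mem_binaryInvariants_iff (d : ℕ) (F : MvPolynomial (Fin (d + 1)) ℂ) :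
    F ∈ binaryInvariants d ↔ raiseDer d F = 0 ∧ lowerDer d F = 0 := by
  rw [← forall_eval_lowerUnipotent_iff, ← forall_eval_upperUnipotent_iff]
  constructor
  · exact fun h => ⟨fun s => h _, fun s => h _⟩
  · rintro ⟨hL, hU⟩ g
    change ∀ a, eval (substCoeffs d g a) F = eval a F
    refine specialLinearGroup_induction (P := fun g => ∀ a, eval (substCoeffs d g a) F = eval a F)
      (fun g h hg hh a => ?_) hU hL g
    rw [substCoeffs_mul, hh, hg]

end Substitutions

/-! ### Weight spaces and the dimension of the space of invariants -/

section WeightSpaceDimension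

open MvPolynomial

/-- The exponents of total degree `n` and weight `m`. -/
def weightExponents (d n : ℕ) (m : ℤ) : Set (Fin (d + 1) →₀ ℕ) :=
  {α | ∑ i, α i = n ∧ ∑ i, (α i : ℤ) * (2 * (i : ℕ) - d) = m}

/-- The polynomials of degree `n` and weight `m`. -/
noncomputable def weightSpace (d n : ℕ) (m : ℤ) : Submodule ℂ (MvPolynomial (Fin (d + 1)) ℂ) :=
  restrictSupport ℂ (weightExponents d n m)

theorem mem_weightSpace_iff {d n : ℕ} {m : ℤ} {F : MvPolynomial (Fin (d + 1)) ℂ} :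
    F ∈ weightSpace d n m ↔
      eulerDer (Fin (d + 1)) F = (n : ℂ) • F ∧ weightDer d F = (m : ℂ) • F := by
  rw [eulerDer, weightDer, diagDer_eq_smul_iff, diagDer_eq_smul_iff, weightSpace,
    mem_restrictSupport_iff, ← forall₂_and]
  refine forall₂_congr fun α _ => ?_
  rw [Finsupp.sum_fintype _ _ (by simp), Finsupp.sum_fintype _ _ (by simp)]
  refine and_congr ?_ ?_
  · rw [← Nat.cast_inj (R := ℂ)]
    simp
  · rw [← Int.cast_inj (α := ℂ)]
    simp

theorem mem_homogeneousSubmodule_iff_eulerDer {d n : ℕ} {F : MvPolynomial (Fin (d + 1)) ℂ} :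
    F ∈ homogeneousSubmodule (Fin (d + 1)) ℂ n ↔ eulerDer (Fin (d + 1)) F = (n : ℂ) • F := by
  rw [eulerDer, diagDer_eq_smul_iff, mem_homogeneousSubmodule, IsHomogeneous,
    IsWeightedHomogeneous]
  refine forall_congr' fun α => ?_
  rw [mem_support_iff]
  refine imp_congr_right fun _ => ?_
  rw [Finsupp.sum_fintype _ _ (by simp), ← Nat.cast_inj (R := ℂ), Finsupp.weight_apply,
    Finsupp.sum_fintype _ _ (by simp)]
  simp

/-- Each variable has weight 2i - d, of absolute value at most d, so n of them have total weight at
most nd in absolute value. -/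
theorem weightSpace_eq_bot {d n : ℕ} {m : ℤ} (h : (n * d : ℤ) < |m|) : weightSpace d n m = ⊥ := by
  rw [eq_bot_iff]
  intro F hF
  rw [weightSpace, mem_restrictSupport_iff] at hF
  rw [Submodule.mem_bot, ← support_eq_empty, Finset.eq_empty_iff_forall_notMem]
  intro α hα
  obtain ⟨h1, h2⟩ := hF hα
  refine absurd h (not_lt.2 ?_)
  rw [← h2, ← h1, Nat.cast_sum, Finset.sum_mul]
  refine (Finset.abs_sum_le_sum_abs _ _).trans (Finset.sum_le_sum fun i _ => ?_)
  rw [abs_mul, Nat.abs_cast]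
  refine mul_le_mul_of_nonneg_left (abs_le.2 ?_) (by positivity)
  have := i.2
  omega

theorem finite_weightExponents (d n : ℕ) (m : ℤ) : (weightExponents d n m).Finite := by
  refine (Set.Finite.preimage (Finsupp.equivFunOnFinite.injective.injOn)
    (Finset.finite_toSet (Finset.Nat.antidiagonalTuple (d + 1) n))).subset fun α hα => ?_
  simpa [Finset.Nat.mem_antidiagonalTuple] using hα.1

instance (d n : ℕ) (m : ℤ) : FiniteDimensional ℂ (weightSpace d n m) :=
  haveI := (finite_weightExponents d n m).to_subtype
  Module.Finite.of_basis (basisRestrictSupport ℂ (weightExponents d n m))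

theorem finrank_weightSpace (d n : ℕ) (m : ℤ) :
    Module.finrank ℂ (weightSpace d n m) = (weightExponents d n m).ncard :=
  Module.finrank_eq_nat_card_basis (basisRestrictSupport ℂ (weightExponents d n m))

theorem raiseDer_lowerDer_sub (d : ℕ) (F : MvPolynomial (Fin (d + 1)) ℂ) :
    raiseDer d (lowerDer d F) - lowerDer d (raiseDer d F) = weightDer d F := by
  rw [← lie_raiseDer_lowerDer, Derivation.commutator_apply]

theorem raiseDer_mem_weightSpace {d n : ℕ} {m : ℤ} {F : MvPolynomial (Fin (d + 1)) ℂ}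
    (h : F ∈ weightSpace d n m) : raiseDer d F ∈ weightSpace d n (m + 2) := by
  rw [mem_weightSpace_iff] at h ⊢
  have h1 := congrArg (· F) (lie_eulerDer_raiseDer d)
  have h2 := congrArg (· F) (lie_weightDer_raiseDer d)
  simp only [Derivation.commutator_apply, Derivation.zero_apply, Derivation.smul_apply, h.1, h.2,
    Derivation.map_smul, sub_eq_iff_eq_add] at h1 h2
  rw [h1, h2]
  refine ⟨by simp, ?_⟩
  push_cast
  module

theorem lowerDer_mem_weightSpace {d n : ℕ} {m : ℤ} {F : MvPolynomial (Fin (d + 1)) ℂ}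
    (h : F ∈ weightSpace d n m) : lowerDer d F ∈ weightSpace d n (m - 2) := by
  rw [mem_weightSpace_iff] at h ⊢
  have h1 := congrArg (· F) (lie_eulerDer_lowerDer d)
  have h2 := congrArg (· F) (lie_weightDer_lowerDer d)
  simp only [Derivation.commutator_apply, Derivation.zero_apply, Derivation.smul_apply, h.1, h.2,
    Derivation.map_smul, sub_eq_iff_eq_add] at h1 h2
  rw [h1, h2]
  refine ⟨by simp, ?_⟩
  push_cast
  module

theorem raiseDer_lowerDer_of_mem {d n : ℕ} {m : ℤ} {F : MvPolynomial (Fin (d + 1)) ℂ}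
    (h : F ∈ weightSpace d n m) :
    raiseDer d (lowerDer d F) - lowerDer d (raiseDer d F) = (m : ℂ) • F := by
  rw [raiseDer_lowerDer_sub, (mem_weightSpace_iff.1 h).2]

/-- The invariants of degree `n` are the vectors of weight zero killed by the lowering operator. -/
theorem binaryInvariantsOfDegree_eq (d n : ℕ) :
    binaryInvariantsOfDegree d n =
      weightSpace d n 0 ⊓ LinearMap.ker (lowerDer d).toLinearMap := by
  ext F
  rw [binaryInvariantsOfDegree, Submodule.mem_inf, Submodule.mem_inf,
    Subalgebra.mem_toSubmodule, mem_binaryInvariants_iff, mem_homogeneousSubmodule_iff_eulerDer,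
    LinearMap.mem_ker, Derivation.coeFn_coe]
  constructor
  · rintro ⟨⟨hD, hL⟩, hn⟩
    refine ⟨mem_weightSpace_iff.2 ⟨hn, ?_⟩, hL⟩
    rw [← raiseDer_lowerDer_sub, hD, hL]
    simp
  · rintro ⟨hF, hL⟩
    refine ⟨⟨?_, hL⟩, (mem_weightSpace_iff.1 hF).1⟩
    have h1 := raiseDer_lowerDer_of_mem hF
    rw [hL, map_zero, zero_sub, Int.cast_zero, zero_smul, neg_eq_zero] at h1
    exact eq_zero_of_raise_lower_eq_zero (raiseDer d).toLinearMap (lowerDer d).toLinearMap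
      (weightSpace d n) (fun m v => raiseDer_mem_weightSpace)
      (fun m v => raiseDer_lowerDer_of_mem) (n * d)
      (fun m hm => weightSpace_eq_bot (hm.trans_le (le_abs_self m))) (m := 0 + 2) (by norm_num)
      (raiseDer_mem_weightSpace hF) ((congrArg (raiseDer d) h1).trans (map_zero _))

theorem finrank_binaryInvariantsOfDegree (d n : ℕ) :
    Module.finrank ℂ (binaryInvariantsOfDegree d n) + (weightExponents d n (-2)).ncard =
      (weightExponents d n 0).ncard := by
  -- The two operators exchange roles and the weights change sign, so the general lemma applies with
  -- lowering as E. This produces weight -2, the one that matches multiplication of the generating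
  -- series by z².
  have h := finrank_ker_raise (lowerDer d).toLinearMap (raiseDer d).toLinearMap
    (fun m => weightSpace d n (-m))
    (fun m v hv => by
      rw [show -(m + 2) = -m - 2 by ring]; exact lowerDer_mem_weightSpace hv)
    (fun m v hv => by
      rw [show -(m - 2) = -m + 2 by ring]; exact raiseDer_mem_weightSpace hv)
    (fun m v hv => by
      have h := raiseDer_lowerDer_of_mem hv
      have h2 : lowerDer d (raiseDer d v) - raiseDer d (lowerDer d v) = (m : ℂ) • v := by
        rw [← neg_sub, h, Int.cast_neg, neg_smul, neg_neg]
      exact h2) (n * d)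
    (fun m hm => weightSpace_eq_bot (by rw [abs_neg]; exact hm.trans_le (le_abs_self m)))
  rw [binaryInvariantsOfDegree_eq, ← finrank_weightSpace, ← finrank_weightSpace]
  simpa using h

end WeightSpaceDimension

/-! ### Gaussian polynomials and the q-binomial theorem -/

section Counting

open PowerSeries

/-- The Gaussian polynomial `∑ q ^ (∑ i αᵢ)`, over the `d`-tuples `α` with sum `n`. -/
noncomputable def tupleSeries (q : PowerSeries ℂ) (d n : ℕ) : PowerSeries ℂ :=
  ∑ α ∈ Finset.Nat.antidiagonalTuple d n, q ^ ∑ i, α i * (i : ℕ)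

/-- Split off the entry of index 0, which carries no weight. If the remaining entries sum to j,
shifting their indices down by one costs the factor q^j. -/
theorem tupleSeries_succ (q : PowerSeries ℂ) (d n : ℕ) :
    tupleSeries q (d + 1) n = ∑ j ∈ Finset.range (n + 1), q ^ j * tupleSeries q d j := by
  have h := Finset.Nat.sum_antidiagonal_eq_sum_range_succ_mk
    (fun p : ℕ × ℕ => q ^ p.2 * tupleSeries q d p.2) n
  have h2 : ∑ j ∈ Finset.range (n + 1), q ^ j * tupleSeries q d j =
      ∑ p ∈ Finset.HasAntidiagonal.antidiagonal n, q ^ p.2 * tupleSeries q d p.2 := by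
    rw [h, ← Finset.sum_range_reflect]
    exact Finset.sum_congr rfl fun j _ => by simp
  rw [h2]
  simp only [tupleSeries, Finset.mul_sum]
  rw [Finset.sum_sigma']
  symm
  refine Finset.sum_bij (fun x _ => (Fin.cons x.1.1 x.2 : Fin (d + 1) → ℕ)) ?_ ?_ ?_ ?_
  · rintro ⟨p, α⟩ hx
    simp only [Finset.mem_sigma, Finset.Nat.mem_antidiagonalTuple] at hx ⊢
    rw [Fin.sum_univ_succ]
    simpa [hx.2] using hx.1
  · rintro ⟨⟨p1, p2⟩, α⟩ hx ⟨⟨p1', p2'⟩, β⟩ hy h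
    simp only [Finset.mem_sigma, Finset.Nat.mem_antidiagonalTuple] at hx hy
    obtain ⟨h1, h3⟩ := Fin.cons_inj.1 h
    simp only at h1 h3
    subst h1 h3
    obtain ⟨-, rfl⟩ := hx
    obtain ⟨-, rfl⟩ := hy
    rfl
  · intro α hα
    rw [Finset.Nat.mem_antidiagonalTuple, Fin.sum_univ_succ] at hα
    refine ⟨⟨(α 0, ∑ i : Fin d, α i.succ), Fin.tail α⟩, ?_, Fin.cons_self_tail α⟩
    simpa [Finset.Nat.mem_antidiagonalTuple, Fin.tail] using hα
  · rintro ⟨p, α⟩ hx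
    simp only [Finset.mem_sigma, Finset.Nat.mem_antidiagonalTuple] at hx
    rw [Fin.sum_univ_succ, ← pow_add]
    simp [mul_add, Finset.sum_add_distrib, hx.2, add_comm]

theorem qShiftedFactorial_succ (a q : PowerSeries ℂ) (n : ℕ) :
    qShiftedFactorial a q (n + 1) = qShiftedFactorial a q n * (1 - a * q ^ n) :=
  Finset.prod_range_succ ..

theorem qShiftedFactorial_succ' (a q : PowerSeries ℂ) (n : ℕ) :
    qShiftedFactorial a q (n + 1) = (1 - a) * qShiftedFactorial (a * q) q n := by
  rw [qShiftedFactorial, Finset.prod_range_succ', mul_comm, qShiftedFactorial]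
  simp [pow_succ', mul_assoc]

/-- The product formula for Gaussian polynomials. -/
theorem qShiftedFactorial_mul_tupleSeries (q : PowerSeries ℂ) (d n : ℕ) :
    qShiftedFactorial q q d * tupleSeries q (d + 1) n = qShiftedFactorial (q ^ (n + 1)) q d := by
  induction d generalizing n with
  | zero =>
    simp [qShiftedFactorial, tupleSeries, Finset.Nat.antidiagonalTuple_one]
  | succ d ih =>
    induction n with
    | zero =>
      simp [tupleSeries, Finset.Nat.antidiagonalTuple_zero_right]
    | succ n ihn =>
      -- The q-Pascal rule: the sums for n + 1 and n differ only in the last term. The inner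
      -- induction on n then uses the outer hypothesis at n + 1.
      have h1 : tupleSeries q (d + 1 + 1) (n + 1) =
          tupleSeries q (d + 1 + 1) n + q ^ (n + 1) * tupleSeries q (d + 1) (n + 1) := by
        rw [tupleSeries_succ q (d + 1) (n + 1), Finset.sum_range_succ, ← tupleSeries_succ]
      have h2 := ih (n + 1)
      rw [h1, mul_add, ihn, qShiftedFactorial_succ q q d, qShiftedFactorial_succ' (q ^ (n + 1)),
        qShiftedFactorial_succ, ← pow_succ]
      linear_combination (1 - q * q ^ d) * q ^ (n + 1) * h2

theorem constantCoeff_qShiftedFactorial {q : PowerSeries ℂ} (hq : constantCoeff q = 0) (n : ℕ) :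
    constantCoeff (qShiftedFactorial q q n) ≠ 0 := by
  simp [qShiftedFactorial, map_prod, hq]

/-- The `q`-binomial theorem. -/
theorem qShiftedFactorial_eq_sum (q x : PowerSeries ℂ) (hq : constantCoeff q = 0) (d : ℕ) :
    qShiftedFactorial (x * q) q d = qShiftedFactorial q q d *
      ∑ k ∈ Finset.range (d + 1), (-1) ^ k * q ^ (k * (k + 1) / 2) * x ^ k *
        (qShiftedFactorial q q k * qShiftedFactorial q q (d - k))⁻¹ := by
  have hne : ∀ n, constantCoeff (qShiftedFactorial q q n) ≠ 0 :=
    constantCoeff_qShiftedFactorial hq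
  have hinv : ∀ n, qShiftedFactorial q q n * (qShiftedFactorial q q n)⁻¹ = 1 := fun n =>
    PowerSeries.mul_inv_cancel _ (hne n)
  have hsucc : ∀ n, (1 - q * q ^ n) * (qShiftedFactorial q q (n + 1))⁻¹ =
      (qShiftedFactorial q q n)⁻¹ := fun n => by
    have h1 := hinv (n + 1)
    rw [qShiftedFactorial_succ] at h1 ⊢
    linear_combination (qShiftedFactorial q q n)⁻¹ * h1 -
      (1 - q * q ^ n) * (qShiftedFactorial q q n * (1 - q * q ^ n))⁻¹ * hinv n
  simp only [PowerSeries.mul_inv_rev]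
  induction d with
  | zero => simp [qShiftedFactorial]
  | succ d ih =>
    set t : ℕ → PowerSeries ℂ := fun k => (-1) ^ k * q ^ (k * (k + 1) / 2) * x ^ k *
      ((qShiftedFactorial q q (d - k))⁻¹ * (qShiftedFactorial q q k)⁻¹) with ht
    set u : ℕ → PowerSeries ℂ := fun k => (-1) ^ k * q ^ (k * (k + 1) / 2) * x ^ k *
      ((qShiftedFactorial q q (d + 1 - k))⁻¹ * (qShiftedFactorial q q k)⁻¹) with hu
    have htri : ∀ k : ℕ, (k + 1) * (k + 1 + 1) / 2 = k * (k + 1) / 2 + (k + 1) := fun k => by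
      rw [show (k + 1) * (k + 1 + 1) = k * (k + 1) + (k + 1) * 2 by ring,
        Nat.add_mul_div_right _ _ two_pos]
    -- Write 1 - q^(d+1) = (1 - q^(d+1-k)) + q^(d+1-k) (1 - q^k). The first part cancels the last
    -- factor of (q, q)_(d+1-k) and leaves t k (`hA`); the second cancels the last factor of (q,
    -- q)_k and, after shifting k by one, leaves -x q^(d+1) times the same sum (`hB`).
    have hmain : (1 - q * q ^ d) * ∑ k ∈ Finset.range (d + 1 + 1), u k =
        (1 - x * q * q ^ d) * ∑ k ∈ Finset.range (d + 1), t k := by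
      have hA : ∑ k ∈ Finset.range (d + 1 + 1), (1 - q ^ (d + 1 - k)) * u k =
          ∑ k ∈ Finset.range (d + 1), t k := by
        rw [Finset.sum_range_succ]
        simp only [Nat.sub_self, pow_zero, sub_self, zero_mul, add_zero]
        refine Finset.sum_congr rfl fun k hk => ?_
        have hk' : d + 1 - k = d - k + 1 := by rw [Finset.mem_range] at hk; omega
        simp only [ht, hu, hk', ← hsucc (d - k), pow_succ']
        ring
      have hB : ∑ k ∈ Finset.range (d + 1 + 1), q ^ (d + 1 - k) * (1 - q ^ k) * u k =
          -(x * q * q ^ d) * ∑ k ∈ Finset.range (d + 1), t k := by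
        rw [Finset.sum_range_succ', Finset.mul_sum]
        simp only [pow_zero, sub_self, mul_zero, zero_mul, add_zero]
        refine Finset.sum_congr rfl fun k hk => ?_
        have hk' : q ^ d = q ^ (d - k) * q ^ k := by
          rw [← pow_add]; congr 1; rw [Finset.mem_range] at hk; omega
        simp only [ht, hu, Nat.add_sub_add_right, ← hsucc k, htri, hk', pow_succ', pow_add]
        ring
      have hAB : (1 - x * q * q ^ d) * ∑ k ∈ Finset.range (d + 1), t k =
          ∑ k ∈ Finset.range (d + 1), t k +
            -(x * q * q ^ d) * ∑ k ∈ Finset.range (d + 1), t k := by ring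
      rw [hAB, ← hB, ← hA, ← Finset.sum_add_distrib, Finset.mul_sum]
      refine Finset.sum_congr rfl fun k hk => ?_
      have hk' : q * q ^ d = q ^ (d + 1 - k) * q ^ k := by
        rw [← pow_add, ← pow_succ']; congr 1; rw [Finset.mem_range] at hk; omega
      rw [hk']
      ring
    rw [qShiftedFactorial_succ, qShiftedFactorial_succ q, mul_assoc (qShiftedFactorial q q d),
      hmain, ih]
    ring

/-- The q-binomial theorem at x = q^n, with the common factor (q, q)_d cancelled against the product
formula. -/
theorem tupleSeries_eq_sum (q : PowerSeries ℂ) (hq : constantCoeff q = 0) (d n : ℕ) :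
    tupleSeries q (d + 1) n =
      ∑ k ∈ Finset.range (d + 1), (-1) ^ k * q ^ (k * (k + 1) / 2) * (q ^ n) ^ k *
        (qShiftedFactorial q q k * qShiftedFactorial q q (d - k))⁻¹ := by
  have h0 : qShiftedFactorial q q d ≠ 0 := fun h =>
    constantCoeff_qShiftedFactorial hq d (by rw [h, map_zero])
  refine mul_left_cancel₀ h0 ?_
  rw [qShiftedFactorial_mul_tupleSeries, pow_succ, qShiftedFactorial_eq_sum q _ hq]

/-- With q = z² a tuple of sum n contributes z to the power 2 ∑ i αᵢ, which is its weight plus nd.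
-/
theorem coeff_tupleSeries (d n e : ℕ) :
    coeff e (tupleSeries (X ^ 2) (d + 1) n) =
      ((weightExponents d n ((e : ℤ) - n * d)).ncard : ℂ) := by
  have h : weightExponents d n ((e : ℤ) - n * d) = Finsupp.equivFunOnFinite ⁻¹'
      ((Finset.Nat.antidiagonalTuple (d + 1) n).filter
        fun α => e = 2 * ∑ i, α i * (i : ℕ) : Finset (Fin (d + 1) → ℕ)) := by
    ext α
    simp only [weightExponents, Set.mem_ofPred_eq, Set.mem_preimage, Finset.mem_coe,
      Finset.mem_filter, Finset.Nat.mem_antidiagonalTuple, Finsupp.equivFunOnFinite_apply]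
    refine and_congr_right fun hn => ?_
    have h1 : ∑ i, (α i : ℤ) * (2 * (i : ℕ) - d) =
        ((2 * ∑ i, α i * (i : ℕ) : ℕ) : ℤ) - n * d := by
      rw [← hn]
      push_cast
      rw [Finset.mul_sum, Finset.sum_mul, ← Finset.sum_sub_distrib]
      exact Finset.sum_congr rfl fun i _ => by ring
    rw [h1]
    omega
  rw [h, Set.ncard_preimage_of_injective_subset_range Finsupp.equivFunOnFinite.injective
    (by simp [Finsupp.equivFunOnFinite.surjective.range_eq]), Set.ncard_coe_finset, tupleSeries,
    map_sum, Finset.card_filter]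
  push_cast
  refine Finset.sum_congr rfl fun α _ => ?_
  rw [← pow_mul, coeff_X_pow]

/-- The Cayley–Sylvester formula. -/
theorem finrank_binaryInvariantsOfDegree_eq_coeff (d n : ℕ) :
    (Module.finrank ℂ (binaryInvariantsOfDegree d n) : ℂ) =
      coeff (n * d) ((1 - X ^ 2) * tupleSeries (X ^ 2) (d + 1) n) := by
  have h := congrArg (Nat.cast (R := ℂ)) (finrank_binaryInvariantsOfDegree d n)
  push_cast at h
  rw [eq_sub_of_add_eq h, sub_mul, one_mul, map_sub, coeff_tupleSeries, coeff_X_pow_mul']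
  push_cast
  rw [sub_self]
  congr 1
  split_ifs with h2
  · rw [coeff_tupleSeries]
    push_cast [Nat.cast_sub h2]
    congr 3
    ring
  -- When nd < 2 the coefficient at nd - 2 is read as 0, which is correct because weight -2 then
  -- lies outside the range of weights.
  · rw [← finrank_weightSpace, weightSpace_eq_bot, finrank_bot, Nat.cast_zero]
    rw [abs_neg, Nat.abs_ofNat]
    exact_mod_cast not_le.1 h2

end Counting

/-! ### The formula for the Poincaré series -/

open PowerSeries in
theorem theorem1 (d : ℕ) (hd : 1 ≤ d) :
    binaryPoincareSeries d =
      ∑ k ∈ (Finset.range d).filter (fun k => 2 * k < d),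
        phi (d - 2 * k)
          ((-1 : PowerSeries ℂ) ^ k * (X : PowerSeries ℂ) ^ (k * (k + 1)) * (1 - X ^ 2) *
            (qShiftedFactorial (X ^ 2) (X ^ 2) k *
              qShiftedFactorial (X ^ 2) (X ^ 2) (d - k))⁻¹) := by
  ext n
  rw [binaryPoincareSeries, coeff_mk, finrank_binaryInvariantsOfDegree_eq_coeff,
    tupleSeries_eq_sum _ (by simp), Finset.mul_sum, map_sum, map_sum]
  have hsub : (Finset.range d).filter (fun k => 2 * k < d) ⊆ Finset.range (d + 1) :=
    (Finset.filter_subset _ _).trans (Finset.range_subset_range.2 (Nat.le_succ d))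
  -- All dependence on n is isolated in the factor z^(2nk); halving k(k + 1) is exact because this
  -- product is even.
  have hterm : ∀ k (U : PowerSeries ℂ), (1 - X ^ 2) *
      ((-1) ^ k * (X ^ 2) ^ (k * (k + 1) / 2) * ((X ^ 2) ^ n) ^ k * U) =
        X ^ (2 * n * k) * ((-1) ^ k * X ^ (k * (k + 1)) * (1 - X ^ 2) * U) := fun k U => by
    have h : 2 * (k * (k + 1) / 2) = k * (k + 1) :=
      Nat.mul_div_cancel' (Nat.even_mul_succ_self k).two_dvd
    rw [← pow_mul X 2, h]
    ring
  simp only [hterm, coeff_X_pow_mul']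
  rw [← Finset.sum_subset hsub]
  · refine Finset.sum_congr rfl fun k hk => ?_
    have hk' := (Finset.mem_filter.1 hk).2
    have h1 : n * d - 2 * n * k = (d - 2 * k) * n := by
      rw [Nat.sub_mul, mul_comm n d, mul_right_comm]
    have h2 : 2 * n * k ≤ n * d := by
      rw [mul_comm 2, mul_assoc]
      exact Nat.mul_le_mul_left n hk'.le
    rw [if_pos h2, h1]
    simp [phi]
  -- For 2k ≥ d, either 2nk > nd and the coefficient is 0, or 2nk = nd and it is a constant term.
  -- The latter vanishes because d ≥ 1 forces k > 0, so z^(k(k+1)) has no constant term.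
  · intro k hk hk'
    have h1 : d ≤ 2 * k := by
      rw [Finset.mem_filter, Finset.mem_range] at hk'
      omega
    split_ifs with h2
    · have h3 : n * d - 2 * n * k = 0 := by
        rw [mul_comm 2, mul_assoc]
        exact Nat.sub_eq_zero_of_le (Nat.mul_le_mul_left n h1)
      have hk0 : k * (k + 1) ≠ 0 := mul_ne_zero (by omega) (by omega)
      rw [h3, coeff_zero_eq_constantCoeff_apply]
      simp [hk0]
    · rfl
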